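/- Let $T\ge 2$ and $r>T^2$ be integers, and suppose we are given a fast matrix multiplication algorithm for $T\times T$ matrices with $r$ multiplications, that is, $r$ products $M_1,\dots,M_r$, each the product of a $\{-1,1\}$-weighted sum of entries of $A$ with a $\{-1,1\}$-weighted sum of entries of $B$, such that every entry of $AB$ is a $\{-1,1\}$-weighted sum of the $M_m$, identically in the $T\times T$ matrices $A,B$. Put $\omega=\log_T r$. A threshold circuit is a directed acyclic network of gates of unbounded fan-in; each gate has constant integer weights $w_i$ and a constant integer threshold $t$, and on the bits $y_i$ entering it (input bits or outputs of other gates) it outputs $1$ if and only if $\sum_i w_i y_i\ge t$. Its size is its number of gates, and its depth is the length of a longest directed path to the output gate, where the input bits are at level $0$. Let $b(N)=O(\log N)$ be a nonnegative-integer-valued function. There are functions $D(N)=O(\log\log N)$ and $S(N)=\widetilde O(N^{\omega})$, where the latter means $S(N)=O(N^{\omega}(\log N)^c)$ for some constant $c$, such that for every $N=T^l$ with $l$ a positive integer and for every integer $\tau$ there is a threshold circuit of depth at most $D(N)$ with at most $S(N)$ gates which, for every $N\times N$ integer matrix $A$ whose entries are given as differences $A_{ij}=A_{ij}^+-A_{ij}^-$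 of nonnegative integers $A_{ij}^{\pm}$ of $b(N)$ bits each, outputs $1$ on the bits of the $A_{ij}^{\pm}$ if and only if $\operatorname{trace}(A^3)\ge\tau$. The functions $D$ and $S$ depend only on the given algorithm and on $b$, not on $\tau$ or $A$. -/

import Mathlib

open Filter Asymptotics

/-- A circuit of linear threshold gates with one output, on input bits indexed by `ι`.
The gate `g` has integer weights `inputWeight g i` on the input bits, integer weights
`gateWeight g h` on the outputs of the other gates, and an integer threshold. A wire runs from
`h` to `g` when `gateWeight g h ≠ 0`; the wires form no directed cycle. Fan-in is unbounded. -/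
structure ThresholdCircuit (ι : Type) where
  Gate : Type
  [fintypeGate : Fintype Gate]
  inputWeight : Gate → ι → ℤ
  gateWeight : Gate → Gate → ℤ
  threshold : Gate → ℤ
  acyclic : WellFounded fun h g : Gate => gateWeight g h ≠ 0
  output : Gate

namespace ThresholdCircuit

attribute [instance] ThresholdCircuit.fintypeGate

variable {ι : Type}

/-- The bit computed by gate `g` on the input `x`: it is `true` if and only if the weighted sum of
the bits that enter `g` is at least the threshold of `g`. -/
noncomputable def gateValue [Fintype ι] (C : ThresholdCircuit ι) (x : ι → Bool) : C.Gate → Bool :=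
  C.acyclic.fix fun g value => decide (C.threshold g ≤
    (∑ i, if x i then C.inputWeight g i else 0) +
      ∑ h, if wire : C.gateWeight g h ≠ 0 then
        (if value h wire then C.gateWeight g h else 0) else 0)

theorem gateValue_eq [Fintype ι] (C : ThresholdCircuit ι) (x : ι → Bool) (g : C.Gate) :
    C.gateValue x g = decide (C.threshold g ≤
      (∑ i, if x i then C.inputWeight g i else 0) +
        ∑ h, if C.gateValue x h then C.gateWeight g h else 0) := by
  rw [gateValue, WellFounded.fix_eq]
  congr 3
  refine Finset.sum_congr rfl fun h _ => ?_
  by_cases wire : C.gateWeight g h = 0 <;> simp [wire]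

/-- The bit that the circuit outputs on the input `x`. -/
noncomputable def eval [Fintype ι] (C : ThresholdCircuit ι) (x : ι → Bool) : Bool :=
  C.gateValue x C.output

/-- The number of gates on a longest directed path of wires that ends in gate `g`. As the input
bits are not counted, this is the length of the path when it is started at an input node. -/
noncomputable def gateDepth (C : ThresholdCircuit ι) : C.Gate → ℕ :=
  C.acyclic.fix fun g depth =>
    1 + Finset.univ.sup fun h => if wire : C.gateWeight g h ≠ 0 then depth h wire else 0

theorem gateDepth_eq (C : ThresholdCircuit ι) (g : C.Gate) :
    C.gateDepth g =
      1 + Finset.univ.sup fun h => if C.gateWeight g h ≠ 0 then C.gateDepth h else 0 := by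
  rw [gateDepth, WellFounded.fix_eq]
  simp only [dite_eq_ite]

/-- The depth of the circuit: the length of a longest path to the output gate. -/
noncomputable def depth (C : ThresholdCircuit ι) : ℕ :=
  C.gateDepth C.output

/-- The number of gates of the circuit. -/
def size (C : ThresholdCircuit ι) : ℕ :=
  Fintype.card C.Gate

end ThresholdCircuit

/-- An algorithm that multiplies two `T × T` matrices with `r` multiplications: the `m`-th
multiplication is the product of a `{-1, 1}`-weighted sum of entries of `A` and a
`{-1, 1}`-weighted sum of entries of `B`, and every entry of `A * B` is a `{-1, 1}`-weighted sum of
these products (a coefficient `0` means that the term does not appear). The identity `correct` is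
bilinear in `A` and `B`, so its validity over the integers is its validity as a formal identity in
noncommuting entries; in particular it may be applied recursively to blocks. -/
structure FastMatMul (T r : ℕ) where
  coeffA : Fin r → Fin T → Fin T → SignType
  coeffB : Fin r → Fin T → Fin T → SignType
  coeffC : Fin r → Fin T → Fin T → SignType
  correct : ∀ (A B : Matrix (Fin T) (Fin T) ℤ) (i j : Fin T),
    (A * B) i j = ∑ m, (coeffC m i j : ℤ) *
      ((∑ p, ∑ q, (coeffA m p q : ℤ) * A p q) * (∑ p, ∑ q, (coeffB m p q : ℤ) * B p q))

/-- Names of the input bits that describe an `N × N` integer matrix: row, column, positive part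
(`true`) or negative part (`false`), and position of the bit, least significant first. -/
abbrev MatrixBit (N b : ℕ) : Type := Fin N × Fin N × Bool × Fin b

/-- The integer matrix described by the bits `x`: its entry at `(i, j)` is the difference of two
nonnegative integers, each given by `b` binary digits. -/
def matrixOfBits {N b : ℕ} (x : MatrixBit N b → Bool) : Matrix (Fin N) (Fin N) ℤ :=
  Matrix.of fun i j =>
    (∑ k : Fin b, if x (i, j, true, k) then (2 : ℤ) ^ (k : ℕ) else 0) -
      ∑ k : Fin b, if x (i, j, false, k) then (2 : ℤ) ^ (k : ℕ) else 0

/-! Unfolding the algorithm `l` times turns the trace of `A ^ 3` into a sum of `r ^ l` products of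
three linear forms in the entries of `A`, with coefficients in `{-1, 0, 1}`: a tensor power of the
one-step identity `sum_traceCoeff` (see `sum_wordValue`). Once the forms are known in binary, one
layer of conjunctions of digits and one output gate decide the inequality (`exists_le_sum_mul`).

It remains to compute the forms. Put `a = T * T`. Level `h` of the recursion has `r ^ h * a ^ (l -
h)` nodes for each of the three factors, and each node is a combination of at most `a ^ (h - g)`
nodes of level `g`. A combination with absolute coefficient sum at most `n` costs depth 2 and `4 * n
+ 1` gates per digit (`linear`). One jump from level `0` to level `l` would need too many gates, and
`l` single steps too much depth. Since `a < r`, some `q` satisfies `a ^ (q + 1) ≤ r ^ q`; hence a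
jump of `R / q + 1` levels that leaves `R` levels to treat costs only `O(r ^ l)` gates per digit
(`level_cost_le`). With such jumps the number of levels left shrinks geometrically, so `O(log l)`
jumps suffice (`le_remaining`). As `l = log_T N`, this gives depth `O(log log N)` and size `r ^ l =
N ^ ω` up to powers of `log N`. -/

namespace ThresholdCircuit

variable {ι : Type}

/-! ### Circuits built layer by layer. -/

/-- The circuit `C` together with one further layer of gates, indexed by `L`, that read the gates
of `C`. -/
abbrev addLayer (C : ThresholdCircuit ι) (L : Type) [Fintype L] (w : L → C.Gate → ℤ)
    (v : L → ι → ℤ) (t : L → ℤ) : ThresholdCircuit ι where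
  Gate := C.Gate ⊕ L
  inputWeight := Sum.elim C.inputWeight v
  gateWeight := Sum.elim (fun g => Sum.elim (C.gateWeight g) fun _ => 0)
    fun k => Sum.elim (w k) fun _ => 0
  threshold := Sum.elim C.threshold t
  acyclic := by
    have hl : ∀ g : C.Gate, Acc (fun h g : C.Gate ⊕ L =>
        (Sum.elim (fun g => Sum.elim (C.gateWeight g) fun _ => 0)
          (fun k => Sum.elim (w k) fun _ => 0) g : C.Gate ⊕ L → ℤ) h ≠ 0) (Sum.inl g) := by
      intro g
      induction g using C.acyclic.induction with
      | _ g ih =>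
        refine ⟨_, fun y hy => ?_⟩
        rcases y with y | y
        · exact ih y hy
        · exact absurd rfl hy
    refine ⟨fun g => ?_⟩
    rcases g with g | k
    · exact hl g
    · refine ⟨_, fun y hy => ?_⟩
      rcases y with y | y
      · exact hl y
      · exact absurd rfl hy
  output := Sum.inl C.output

section addLayer

variable (C : ThresholdCircuit ι) (L : Type) [Fintype L] (w : L → C.Gate → ℤ)
    (v : L → ι → ℤ) (t : L → ℤ)

theorem size_addLayer : (C.addLayer L w v t).size = C.size + Fintype.card L :=
  Fintype.card_sum

theorem gateValue_addLayer_inl [Fintype ι] (x : ι → Bool) (g : C.Gate) :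
    (C.addLayer L w v t).gateValue x (Sum.inl g) = C.gateValue x g := by
  induction g using C.acyclic.induction with
  | _ g ih =>
    rw [gateValue_eq, gateValue_eq]
    refine congrArg (fun z => decide (C.threshold g ≤
      (∑ i, if x i then C.inputWeight g i else 0) + z)) ?_
    refine (Fintype.sum_sum_type _).trans ?_
    simp only [Sum.elim_inl, Sum.elim_inr, ite_self, Finset.sum_const_zero, add_zero]
    refine Finset.sum_congr rfl fun h _ => ?_
    by_cases hw : C.gateWeight g h = 0
    · simp [hw]
    · exact congrArg (fun b : Bool => if b then C.gateWeight g h else 0) (ih h hw)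

theorem gateValue_addLayer_inr [Fintype ι] (x : ι → Bool) (k : L) :
    (C.addLayer L w v t).gateValue x (Sum.inr k) = decide (t k ≤
      (∑ i, if x i then v k i else 0) + ∑ g, if C.gateValue x g then w k g else 0) := by
  rw [gateValue_eq]
  congr 3
  refine (Fintype.sum_sum_type _).trans ?_
  simp only [Sum.elim_inl, Sum.elim_inr, ite_self, Finset.sum_const_zero, add_zero]
  refine Finset.sum_congr rfl fun h _ => ?_
  exact congrArg (fun b : Bool => if b then w k h else 0) (C.gateValue_addLayer_inl L w v t x h)

theorem gateDepth_addLayer_inl (g : C.Gate) :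
    (C.addLayer L w v t).gateDepth (Sum.inl g) ≤ C.gateDepth g := by
  induction g using C.acyclic.induction with
  | _ g ih =>
    rw [gateDepth_eq, gateDepth_eq]
    refine Nat.add_le_add_left (Finset.sup_le fun h _ => ?_) _
    rcases h with h | h
    · by_cases hw : C.gateWeight g h = 0
      · simp [hw]
      · refine le_trans ?_ (Finset.le_sup (Finset.mem_univ h))
        rw [if_pos hw, if_pos (show (C.addLayer L w v t).gateWeight (Sum.inl g) (Sum.inl h) ≠ 0 from hw)]
        exact ih h hw
    · rw [if_neg (by simp)]
      exact Nat.zero_le _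

theorem gateDepth_addLayer_inr {d : ℕ} (hd : ∀ g, C.gateDepth g ≤ d) (k : L) :
    (C.addLayer L w v t).gateDepth (Sum.inr k) ≤ d + 1 := by
  rw [gateDepth_eq, add_comm]
  refine Nat.add_le_add_right (Finset.sup_le fun h _ => ?_) _
  rcases h with h | h
  · split_ifs
    · exact (C.gateDepth_addLayer_inl L w v t h).trans (hd h)
    · exact Nat.zero_le _
  · rw [if_neg (by simp)]
    exact Nat.zero_le _

end addLayer

/-- The Boolean functions `f k` are all computed by gates of one circuit with at most `s` gates,
in which every gate has depth at most `d`. -/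
def Computes [Fintype ι] (d s : ℕ) {κ : Type} (f : κ → (ι → Bool) → Bool) : Prop :=
  ∃ C : ThresholdCircuit ι, (∀ g, C.gateDepth g ≤ d) ∧ C.size ≤ s ∧
    ∀ k, ∃ g, ∀ x, C.gateValue x g = f k x

namespace Computes

variable [Fintype ι] {d s : ℕ} {κ κ' : Type} {f : κ → (ι → Bool) → Bool}

/-- Threshold gates that read the input bits. A constant gate serves as the start of the circuit. -/
theorem input_forms [Fintype κ] (v : κ → ι → ℤ) (t : κ → ℤ) :
    Computes 2 (1 + Fintype.card κ)
      fun k (x : ι → Bool) => decide (t k ≤ ∑ i, if x i then v k i else 0) := by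
  let C : ThresholdCircuit ι :=
    { Gate := Unit
      inputWeight := fun _ _ => 0
      gateWeight := fun _ _ => 0
      threshold := fun _ => 0
      acyclic := ⟨fun _ => ⟨_, fun _ h => absurd rfl h⟩⟩
      output := () }
  have hC : ∀ g, C.gateDepth g ≤ 1 := by
    intro g
    rw [gateDepth_eq]
    simp [C]
  refine ⟨C.addLayer κ (fun _ _ => 0) v t, ?_, ?_, fun k => ⟨Sum.inr k, fun x => ?_⟩⟩
  · rintro (g | k)
    · exact (C.gateDepth_addLayer_inl ..).trans ((hC g).trans one_le_two)
    · exact C.gateDepth_addLayer_inr _ _ _ _ hC k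
  · rw [size_addLayer]
    exact le_rfl
  · rw [gateValue_addLayer_inr]
    simp

/-- A further layer of threshold gates. -/
theorem layer [Fintype κ] (hf : Computes d s f) [Fintype κ'] (w : κ' → κ → ℤ) (t : κ' → ℤ) :
    Computes (d + 1) (s + Fintype.card κ')
      fun k' x => decide (t k' ≤ ∑ k, if f k x then w k' k else 0) := by
  classical
  obtain ⟨C, hd, hs, hC⟩ := hf
  choose γ hγ using hC
  -- One gate may compute several of the `f k`; it then carries the sum of their weights.
  refine ⟨C.addLayer κ' (fun k' g => ∑ k with γ k = g, w k' k) (fun _ _ => 0) t, ?_, ?_,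
    fun k' => ⟨Sum.inr k', fun x => ?_⟩⟩
  · rintro (g | k)
    · exact (C.gateDepth_addLayer_inl ..).trans ((hd g).trans (Nat.le_succ d))
    · exact C.gateDepth_addLayer_inr _ _ _ _ hd k
  · rw [size_addLayer]
    exact Nat.add_le_add_right hs _
  · rw [gateValue_addLayer_inr]
    congr 2
    simp only [ite_self, Finset.sum_const_zero, zero_add]
    rw [← Finset.sum_fiberwise (s := Finset.univ) (g := γ)]
    refine Finset.sum_congr rfl fun g _ => ?_
    by_cases hg : C.gateValue x g = true
    · rw [if_pos hg]
      refine Finset.sum_congr rfl fun k hk => ?_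
      rw [← hγ, (Finset.mem_filter.1 hk).2, if_pos hg]
    · rw [if_neg hg]
      refine (Finset.sum_eq_zero fun k hk => ?_).symm
      rw [← hγ, (Finset.mem_filter.1 hk).2, if_neg hg]

theorem mono {d' s' : ℕ} (hf : Computes d s f) (hd : d ≤ d') (hs : s ≤ s') : Computes d' s' f := by
  obtain ⟨C, h1, h2, h3⟩ := hf
  exact ⟨C, fun g => (h1 g).trans hd, h2.trans hs, h3⟩

theorem comp (hf : Computes d s f) (φ : κ' → κ) : Computes d s fun k => f (φ k) := by
  obtain ⟨C, h1, h2, h3⟩ := hf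
  exact ⟨C, h1, h2, fun k => h3 (φ k)⟩

theorem congr {f' : κ → (ι → Bool) → Bool} (hf : Computes d s f) (h : ∀ k x, f k x = f' k x) :
    Computes d s f' := by
  rwa [show f' = f from funext fun k => funext fun x => (h k x).symm]

/-- Values and depths of gates do not depend on which gate is the output, so the output can be
chosen last. -/
theorem exists_eval (hf : Computes d s f) (k : κ) :
    ∃ C : ThresholdCircuit ι, C.depth ≤ d ∧ C.size ≤ s ∧ ∀ x, C.eval x = f k x := by
  obtain ⟨C, h1, h2, h3⟩ := hf
  obtain ⟨g, hg⟩ := h3 k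
  refine ⟨{ C with output := g }, h1 g, h2, hg⟩

/-- The parity of `⌊(c + L) / 2 ^ e⌋` for a linear form `L` in computed bits is found in two
layers. -/
theorem parity [Fintype κ] (hf : Computes d s f) [Fintype κ'] (w : κ' → κ → ℤ) (c : κ' → ℤ)
    (e : κ' → ℕ) (n : ℕ)
    (h0 : ∀ k' x, 0 ≤ c k' + ∑ k, if f k x then w k' k else 0)
    (hn : ∀ k' x, c k' + (∑ k, if f k x then w k' k else 0) ≤ n * 2 ^ e k') :
    Computes (d + 2) (s + Fintype.card κ' * (n + 1))
      fun k' x => decide ((c k' + ∑ k, if f k x then w k' k else 0) / 2 ^ e k' % 2 = 1) := by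
  classical
  -- Gate `(k', j)` fires exactly when the quotient `q` exceeds `j`. Weighted by `(-1) ^ j`, the
  -- firing gates `j < q` sum to `0` or `1` according to the parity of `q`.
  have h1 := hf.layer (κ' := κ' × Fin n) (fun p k => w p.1 k)
    (fun p => (p.2.1 + 1) * 2 ^ e p.1 - c p.1)
  have h2 := h1.layer (κ' := κ') (fun k' p => if p.1 = k' then (-1) ^ p.2.1 else 0) (fun _ => 1)
  refine (h2.mono le_rfl (le_of_eq ?_)).congr fun k' x => ?_
  · rw [Fintype.card_prod, Fintype.card_fin]
    ring
  · set S := c k' + ∑ k, if f k x then w k' k else 0 with hS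
    obtain ⟨q, hq⟩ := Int.eq_ofNat_of_zero_le (Int.ediv_nonneg (h0 k' x) (by positivity : (0 : ℤ) ≤ 2 ^ e k'))
    rw [← hS] at hq
    have hqn : q ≤ n := by
      have : S / 2 ^ e k' ≤ n := by
        refine (Int.ediv_le_ediv (by positivity) (hn k' x)).trans ?_
        rw [Int.mul_ediv_cancel _ (by positivity)]
      rw [hq] at this
      exact_mod_cast this
    have key : (∑ p : κ' × Fin n, if decide ((p.2.1 + 1) * 2 ^ e p.1 - c p.1 ≤
        ∑ k, if f k x then w p.1 k else 0) then (if p.1 = k' then (-1 : ℤ) ^ p.2.1 else 0) else 0)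
        = if Even q then 0 else 1 := by
      rw [← neg_one_geom_sum (R := ℤ), Fintype.sum_prod_type, Finset.sum_eq_single k']
      · have : ∀ j : Fin n, ((j.1 + 1) * 2 ^ e k' - c k' ≤ ∑ k, if f k x then w k' k else 0)
            ↔ j.1 < q := by
          intro j
          rw [sub_le_iff_le_add', ← hS, ← Int.le_ediv_iff_mul_le (by positivity), hq]
          omega
        simp only [decide_eq_true_eq, this, if_true]
        rw [Fin.sum_univ_eq_sum_range (fun j => if j < q then (-1 : ℤ) ^ j else 0) n,
          ← Finset.sum_filter]
        congr 1
        ext j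
        simp only [Finset.mem_filter, Finset.mem_range]
        omega
      · intro j _ hj
        simp [hj]
      · simp
    rw [key, hq]
    rcases Nat.even_or_odd q with h | h
    · have : (q : ℤ) % 2 ≠ 1 := by obtain ⟨a, rfl⟩ := h; omega
      simp [h, this]
    · have h' : (q : ℤ) % 2 = 1 := by obtain ⟨a, rfl⟩ := h; omega
      simp [Nat.not_even_iff_odd.2 h, h']

end Computes

end ThresholdCircuit

/-! ### Two's complement digits. -/

/-- An integer modulo `2 ^ K` is determined by its low binary digits in two's complement. -/
theorem Int.emod_two_pow_eq_sum (v : ℤ) (K : ℕ) :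
    v % 2 ^ K = ∑ k ∈ Finset.range K, if v / 2 ^ k % 2 = 1 then (2 : ℤ) ^ k else 0 := by
  induction K with
  | zero => simp
  | succ K ih =>
    rw [Finset.sum_range_succ, ← ih, Int.emod_def v (2 ^ (K + 1)), Int.emod_def v (2 ^ K), pow_succ,
      ← Int.ediv_ediv_of_nonneg (by positivity)]
    set q := v / 2 ^ K
    have hq := Int.emod_add_mul_ediv q 2
    rcases Int.emod_two_eq_zero_or_one q with h | h
    · rw [if_neg (by omega)]
      linear_combination (2 : ℤ) ^ K * (-hq + h)
    · rw [if_pos h]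
      linear_combination (2 : ℤ) ^ K * (-hq + h)

/-- Floor division by `2 ^ B` gives `0` or `-1`, so digit `B` is the sign, and its weight `-2 ^ B`
corrects the residue modulo `2 ^ B`. -/
theorem Int.eq_sum_digits {v : ℤ} {B : ℕ} (h0 : -2 ^ B ≤ v) (h1 : v < 2 ^ B) :
    v = ∑ k : Fin (B + 1), if v / 2 ^ (k : ℕ) % 2 = 1 then
      (if (k : ℕ) = B then -2 ^ B else (2 : ℤ) ^ (k : ℕ)) else 0 := by
  rw [Fin.sum_univ_eq_sum_range (fun k => if v / 2 ^ k % 2 = 1 then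
      (if k = B then -2 ^ B else (2 : ℤ) ^ k) else 0) (B + 1), Finset.sum_range_succ, if_pos rfl]
  have : ∑ k ∈ Finset.range B, (if v / 2 ^ k % 2 = 1 then
      (if k = B then -2 ^ B else (2 : ℤ) ^ k) else 0) = v % 2 ^ B := by
    rw [Int.emod_two_pow_eq_sum]
    refine Finset.sum_congr rfl fun k hk => ?_
    rw [if_neg (Finset.mem_range.1 hk).ne]
  rw [this]
  have hp : (0 : ℤ) < 2 ^ B := by positivity
  rcases le_or_gt 0 v with h | h
  · rw [Int.ediv_eq_zero_of_lt h h1, Int.emod_eq_of_lt h h1]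
    simp
  · have h2 : v / 2 ^ B = -1 := by
      rw [Int.ediv_eq_iff_of_pos hp]
      constructor <;> linarith
    rw [Int.emod_def, h2]
    norm_num

/-- This makes overflow harmless: low digits of a linear combination are right whatever the size of
the intermediate values. -/
theorem Int.ediv_two_pow_emod_two_congr {u v : ℤ} {k : ℕ} (h : u ≡ v [ZMOD 2 ^ (k + 1)]) :
    u / 2 ^ k % 2 = v / 2 ^ k % 2 := by
  obtain ⟨c, hc⟩ := h.dvd
  have : v = u + 2 * c * 2 ^ k := by
    rw [pow_succ] at hc
    linear_combination hc
  rw [this, Int.add_mul_ediv_right _ _ (by positivity)]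
  omega

theorem Int.digit_sum_two_pow {b : ℕ} (f : Fin b → Bool) (p : ℕ) :
    (∑ j : Fin b, if f j then (2 : ℤ) ^ (j : ℕ) else 0) / 2 ^ p % 2 = 1 ↔
      ∃ h : p < b, f ⟨p, h⟩ = true := by
  induction b generalizing p with
  | zero => simp
  | succ b ih =>
    have hs : (∑ j : Fin (b + 1), if f j then (2 : ℤ) ^ (j : ℕ) else 0) =
        (if f 0 then 1 else 0) + 2 * ∑ j : Fin b, if f j.succ then (2 : ℤ) ^ (j : ℕ) else 0 := by
      rw [Fin.sum_univ_succ, Finset.mul_sum]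
      congr 1
      refine Finset.sum_congr rfl fun j _ => ?_
      simp [pow_succ', mul_ite]
    rw [hs]
    cases p with
    | zero =>
      rw [pow_zero, Int.ediv_one]
      cases h : f 0
      · simp [h]
      · simp [h]
    | succ p =>
      rw [pow_succ', ← Int.ediv_ediv_of_nonneg (by norm_num), Int.add_mul_ediv_left _ _ (by norm_num)]
      have h0 : (if f 0 = true then (1 : ℤ) else 0) / 2 = 0 := by split_ifs <;> rfl
      rw [h0, zero_add, ih fun j => f j.succ]
      simp

/-! ### Integer arithmetic by threshold circuits. -/

namespace ThresholdCircuit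

variable {ι : Type} [Fintype ι]

/-- The integer-valued functions `v j` are all computed by one circuit with at most `s` gates and
depth at most `d`, as their `B` lowest binary digits in two's complement. -/
def ComputesInt (d s B : ℕ) {κ : Type} (v : κ → (ι → Bool) → ℤ) : Prop :=
  Computes d s fun (p : κ × Fin B) x => decide (v p.1 x / 2 ^ (p.2 : ℕ) % 2 = 1)

namespace ComputesInt

variable {d s B : ℕ} {κ I : Type} {v : κ → (ι → Bool) → ℤ}

theorem mono {d' s' : ℕ} (hv : ComputesInt d s B v) (hd : d ≤ d') (hs : s ≤ s') :
    ComputesInt d' s' B v :=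
  Computes.mono hv hd hs

theorem comp (hv : ComputesInt d s B v) (φ : I → κ) : ComputesInt d s B fun i => v (φ i) :=
  Computes.comp hv fun p : I × Fin B => (φ p.1, p.2)

/-- Integer linear combinations are computed in two layers. -/
theorem linear [Fintype κ] [Fintype I] (hv : ComputesInt d s B v) {u : I → (ι → Bool) → ℤ}
    (a : I → κ → ℤ) (n : ℕ) (hu : ∀ i x, u i x = ∑ j, a i j * v j x)
    (ha : ∀ i, ∑ j, |a i j| ≤ n) :
    ComputesInt (d + 2) (s + Fintype.card I * B * (4 * n + 1)) B u := by
  -- Digit `k` of the result reads only the digits up to `k`, so the form is at most `n * 2 ^ (k +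
  -- 1)` in absolute value and the gate count per digit does not grow with `B`.
  have hL : ∀ (p : I × Fin B) (x : ι → Bool),
      (∑ q : κ × Fin B, if decide (v q.1 x / 2 ^ (q.2 : ℕ) % 2 = 1) then
        (if q.2 ≤ p.2 then a p.1 q.1 * 2 ^ (q.2 : ℕ) else 0) else 0) =
      ∑ j, a p.1 j * (v j x % 2 ^ ((p.2 : ℕ) + 1)) := by
    rintro ⟨i, k⟩ x
    rw [Fintype.sum_prod_type]
    refine Finset.sum_congr rfl fun j _ => ?_
    simp only [decide_eq_true_eq, Int.emod_two_pow_eq_sum, Finset.mul_sum]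
    rw [← Finset.sum_subset (s₁ := Finset.univ.filter (· ≤ k)) (Finset.subset_univ _)]
    · refine Finset.sum_bij (fun k' _ => (k' : ℕ)) ?_ ?_ ?_ ?_
      · intro k' hk'
        exact Finset.mem_range.2 (Nat.lt_succ_of_le (Finset.mem_filter.1 hk').2)
      · intro k₁ _ k₂ _ h
        exact Fin.ext h
      · intro m hm
        have hm := Finset.mem_range.1 hm
        exact ⟨⟨m, by omega⟩, Finset.mem_filter.2 ⟨Finset.mem_univ _,
          Fin.le_def.2 (Nat.le_of_lt_succ hm)⟩, rfl⟩
      · intro k' hk'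
        simp [(Finset.mem_filter.1 hk').2]
    · intro k' _ hk'
      have : ¬ k' ≤ k := fun h => hk' (Finset.mem_filter.2 ⟨Finset.mem_univ _, h⟩)
      simp [this]
  have hbound : ∀ (p : I × Fin B) (x : ι → Bool),
      |∑ j, a p.1 j * (v j x % 2 ^ ((p.2 : ℕ) + 1))| ≤ n * 2 ^ ((p.2 : ℕ) + 1) := by
    intro p x
    refine (Finset.abs_sum_le_sum_abs _ _).trans ?_
    refine (Finset.sum_le_sum fun j _ => ?_).trans ((Finset.sum_mul _ _ _).symm.le.trans
      (mul_le_mul_of_nonneg_right (ha p.1) (by positivity)))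
    rw [abs_mul, abs_of_nonneg (Int.emod_nonneg _ (by positivity))]
    exact mul_le_mul_of_nonneg_left (Int.emod_lt_of_pos _ (by positivity)).le (abs_nonneg _)
  -- The offset `n * 2 ^ (k + 1)` makes the form nonnegative without changing digit `k`; the form
  -- then stays below `2 * n * 2 ^ (k + 1) = 4 * n * 2 ^ k`.
  have h := Computes.parity hv (κ' := I × Fin B)
    (fun p q => if q.2 ≤ p.2 then a p.1 q.1 * 2 ^ (q.2 : ℕ) else 0)
    (fun p => n * 2 ^ ((p.2 : ℕ) + 1)) (fun p => p.2) (4 * n) ?_ ?_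
  · refine (h.mono le_rfl ?_).congr fun p x => ?_
    · rw [Fintype.card_prod, Fintype.card_fin]
    · rw [hL]
      congr 2
      refine Int.ediv_two_pow_emod_two_congr ?_
      rw [hu]
      have h1 : ∑ j, a p.1 j * (v j x % 2 ^ ((p.2 : ℕ) + 1)) ≡ ∑ j, a p.1 j * v j x
          [ZMOD 2 ^ ((p.2 : ℕ) + 1)] :=
        Int.ModEq.sum fun j _ => (Int.mod_modEq _ _).mul_left _
      simpa using (Int.modEq_zero_iff_dvd.2 (dvd_mul_left _ (n : ℤ))).add h1
  · intro p x
    rw [hL]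
    linarith [(abs_le.1 (hbound p x)).1]
  · intro p x
    rw [hL]
    have := (abs_le.1 (hbound p x)).2
    push_cast
    rw [pow_succ] at this ⊢
    linarith

/-- Differences of nonnegative integers that are given by input bits. -/
theorem ofInput [Fintype κ] {b : ℕ} (B : ℕ) (z : κ → Bool → Fin b → ι) :
    ComputesInt 4 (1 + Fintype.card κ * (2 * B) + Fintype.card κ * B * 9) B
      fun j (x : ι → Bool) => (∑ k : Fin b, if x (z j true k) then (2 : ℤ) ^ (k : ℕ) else 0) -
        ∑ k : Fin b, if x (z j false k) then (2 : ℤ) ^ (k : ℕ) else 0 := by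
  classical
  have h1 : ComputesInt 2 (1 + Fintype.card κ * (2 * B)) B fun (p : κ × Bool) (x : ι → Bool) =>
      ∑ k : Fin b, if x (z p.1 p.2 k) then (2 : ℤ) ^ (k : ℕ) else 0 := by
    -- These gates copy the input bits, since later layers read only gates; at positions from `b`
    -- on, weight `0` against threshold `1` gives the digit `0`.
    refine ((Computes.input_forms (κ := (κ × Bool) × Fin B)
      (fun p i => if h : (p.2 : ℕ) < b then (if i = z p.1.1 p.1.2 ⟨p.2, h⟩ then 1 else 0) else 0)
      (fun _ => 1)).mono le_rfl ?_).congr fun p x => ?_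
    · simp [mul_assoc]
    · rw [decide_eq_decide, Int.digit_sum_two_pow fun k => x (z p.1.1 p.1.2 k)]
      by_cases h : (p.2 : ℕ) < b
      · have : (∑ i, if x i then (if i = z p.1.1 p.1.2 ⟨p.2, h⟩ then (1 : ℤ) else 0) else 0) =
            if x (z p.1.1 p.1.2 ⟨p.2, h⟩) then 1 else 0 := by
          rw [Finset.sum_eq_single (z p.1.1 p.1.2 ⟨p.2, h⟩)]
          · simp
          · intro i _ hi
            simp [hi]
          · simp
        simp only [h, dite_true, this, exists_true_left]
        split_ifs with hx <;> simp [hx]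
      · simp [h]
  refine h1.linear (fun i p => if p.1 = i then (if p.2 then 1 else -1) else 0) 2 ?_ ?_
  · intro i x
    rw [Fintype.sum_prod_type, Finset.sum_eq_single i]
    · simp [sub_eq_add_neg]
    · intro j _ hj
      simp [hj]
    · simp
  · intro i
    rw [Fintype.sum_prod_type, Finset.sum_eq_single i]
    · simp
    · intro j _ hj
      simp [hj]
    · simp

/-- Comparing a sum of products of three computed integers with a constant takes two layers. -/
theorem exists_le_sum_mul {M : Type} [Fintype M] {v : Fin 3 × M → (ι → Bool) → ℤ}
    (hv : ComputesInt d s (B + 1) v) (h0 : ∀ p x, -2 ^ B ≤ v p x) (h1 : ∀ p x, v p x < 2 ^ B)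
    (τ : ℤ) :
    ∃ C : ThresholdCircuit ι, C.depth ≤ d + 2 ∧ C.size ≤ s + Fintype.card M * (B + 1) ^ 3 + 1 ∧
      ∀ x, C.eval x = true ↔ τ ≤ ∑ m, v (0, m) x * v (1, m) x * v (2, m) x := by
  classical
  let ε : Fin (B + 1) → ℤ := fun k => if (k : ℕ) = B then -2 ^ B else 2 ^ (k : ℕ)
  -- A conjunction of one digit from each factor: three distinct digits of weight `1` against
  -- threshold `3`. The output gate weights it by the product of the three digit weights `ε`.
  have hand := Computes.layer hv (κ' := M × Fin (B + 1) × Fin (B + 1) × Fin (B + 1))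
    (fun p q => (if q = ((0, p.1), p.2.1) then 1 else 0) +
      (if q = ((1, p.1), p.2.2.1) then 1 else 0) + (if q = ((2, p.1), p.2.2.2) then 1 else 0))
    (fun _ => 3)
  have hout := hand.layer (κ' := Unit) (fun _ p => ε p.2.1 * ε p.2.2.1 * ε p.2.2.2) (fun _ => τ)
  obtain ⟨C, hd, hs, hC⟩ := hout.exists_eval ()
  refine ⟨C, hd, hs.trans (le_of_eq ?_), fun x => ?_⟩
  · simp only [Fintype.card_prod, Fintype.card_fin, Fintype.card_unit]
    ring
  · rw [hC, decide_eq_true_iff]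
    refine iff_of_eq (congrArg _ ?_)
    rw [Fintype.sum_prod_type]
    refine Finset.sum_congr rfl fun m _ => ?_
    rw [Int.eq_sum_digits (h0 (0, m) x) (h1 (0, m) x), Int.eq_sum_digits (h0 (1, m) x) (h1 (1, m) x),
      Int.eq_sum_digits (h0 (2, m) x) (h1 (2, m) x), Finset.sum_mul_sum, Finset.sum_mul,
      Fintype.sum_prod_type]
    refine Finset.sum_congr rfl fun k₀ _ => ?_
    rw [Finset.sum_mul, Fintype.sum_prod_type]
    refine Finset.sum_congr rfl fun k₁ _ => ?_
    rw [Finset.mul_sum]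
    refine Finset.sum_congr rfl fun k₂ _ => ?_
    have key : (∑ q : (Fin 3 × M) × Fin (B + 1), if decide (v q.1 x / 2 ^ (q.2 : ℕ) % 2 = 1) then
        (((if q = ((0, m), k₀) then 1 else 0) + (if q = ((1, m), k₁) then 1 else 0) +
          (if q = ((2, m), k₂) then 1 else 0) : ℤ)) else 0) =
        (if v (0, m) x / 2 ^ (k₀ : ℕ) % 2 = 1 then 1 else 0) +
        (if v (1, m) x / 2 ^ (k₁ : ℕ) % 2 = 1 then 1 else 0) +
        (if v (2, m) x / 2 ^ (k₂ : ℕ) % 2 = 1 then 1 else 0) := by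
      have hsingle : ∀ q₀ : (Fin 3 × M) × Fin (B + 1),
          (∑ q : (Fin 3 × M) × Fin (B + 1), if decide (v q.1 x / 2 ^ (q.2 : ℕ) % 2 = 1) then
            (if q = q₀ then (1 : ℤ) else 0) else 0) =
          if v q₀.1 x / 2 ^ (q₀.2 : ℕ) % 2 = 1 then 1 else 0 := by
        intro q₀
        rw [Finset.sum_eq_single q₀]
        · simp
        · intro q _ hq
          simp [hq]
        · simp
      rw [← hsingle ((0, m), k₀), ← hsingle ((1, m), k₁), ← hsingle ((2, m), k₂),
        ← Finset.sum_add_distrib, ← Finset.sum_add_distrib]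
      refine Finset.sum_congr rfl fun q _ => ?_
      split_ifs <;> rfl
    simp only [key]
    by_cases e0 : v (0, m) x / 2 ^ (k₀ : ℕ) % 2 = 1 <;>
    by_cases e1 : v (1, m) x / 2 ^ (k₁ : ℕ) % 2 = 1 <;>
    by_cases e2 : v (2, m) x / 2 ^ (k₂ : ℕ) % 2 = 1 <;>
    simp [e0, e1, e2, ε]

end ComputesInt

end ThresholdCircuit

theorem Finset.prod_ite_const_fin (l g a b : ℕ) (hg : g ≤ l) :
    ∏ k : Fin l, (if (k : ℕ) < g then a else b) = a ^ g * b ^ (l - g) := by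
  rw [Fin.prod_univ_eq_prod_range (fun k => if k < g then a else b) l, Finset.prod_ite,
    Finset.prod_const, Finset.prod_const]
  congr 2
  · rw [show (Finset.range l).filter (· < g) = Finset.range g by ext; simp; omega, Finset.card_range]
  · rw [show (Finset.range l).filter (fun k => ¬ k < g) = Finset.Ico g l by ext; simp; omega,
      Nat.card_Ico]

/-! ### Nodes of the recursion as mixed words. -/

section Words

variable {α β : Type} [Fintype β] [DecidableEq α] [DecidableEq β]

/-- The coefficient with which the letter `e'` contributes to the letter `e`. -/
def letterCoeff (c : α → β → ℤ) : α ⊕ β → α ⊕ β → ℤ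
  | Sum.inl m, Sum.inl m' => if m = m' then 1 else 0
  | Sum.inl m, Sum.inr Q => c m Q
  | Sum.inr _, Sum.inl _ => 0
  | Sum.inr Q, Sum.inr Q' => if Q = Q' then 1 else 0

/-- The letters allowed in position `k` of a word of level `g`. -/
def levelLetters (α β : Type) [Fintype α] [Fintype β] (g k : ℕ) : Finset (α ⊕ β) :=
  if k < g then Finset.univ.map Function.Embedding.inl else Finset.univ.map Function.Embedding.inr

/-- The words of length `l` in which exactly the first `g` letters are from `α`. -/
def levelWords (α β : Type) [Fintype α] [Fintype β] [DecidableEq α] [DecidableEq β]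
    (l g : ℕ) : Finset (Fin l → α ⊕ β) :=
  Fintype.piFinset fun k => levelLetters α β g k

/-- The entry, at the position that the letters from `β` describe, of the block combination that
the letters from `α` describe. -/
def wordValue {l : ℕ} (c : α → β → ℤ) (A : (Fin l → β) → ℤ) (w : Fin l → α ⊕ β) : ℤ :=
  ∑ P : Fin l → β, (∏ k, letterCoeff c (w k) (Sum.inr (P k))) * A P

theorem abs_wordValue_le {l : ℕ} (c : α → β → ℤ) (hc : ∀ m Q, |c m Q| ≤ 1) {A : (Fin l → β) → ℤ}
    {D : ℤ} (hA : ∀ P, |A P| ≤ D) (w : Fin l → α ⊕ β) :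
    |wordValue c A w| ≤ Fintype.card β ^ l * D := by
  have hK : ∀ (e : α ⊕ β) (z : β), |letterCoeff c e (Sum.inr z)| ≤ 1 := by
    rintro (m | Q) z
    · exact hc m z
    · simp only [letterCoeff]
      split_ifs <;> simp
  refine (Finset.abs_sum_le_sum_abs _ _).trans
    ((Finset.sum_le_sum (g := fun _ => D) fun P _ => ?_).trans (le_of_eq (by simp)))
  rw [abs_mul, Finset.abs_prod]
  refine (mul_le_of_le_one_left (abs_nonneg _) ?_).trans (hA P)
  exact Finset.prod_le_one (fun _ _ => abs_nonneg _) fun k _ => hK _ _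

theorem wordValue_inr {l : ℕ} (c : α → β → ℤ) (A : (Fin l → β) → ℤ) (Q : Fin l → β) :
    (wordValue c A fun k => Sum.inr (Q k)) = A Q := by
  unfold wordValue
  rw [Finset.sum_eq_single Q]
  · simp [letterCoeff]
  · intro P _ hP
    obtain ⟨k, hk⟩ := Function.ne_iff.1 hP
    rw [Finset.prod_eq_zero (Finset.mem_univ k), zero_mul]
    simp [letterCoeff, hk.symm]
  · simp

variable [Fintype α]

theorem card_levelWords {l g : ℕ} (hg : g ≤ l) :
    (levelWords α β l g).card = Fintype.card α ^ g * Fintype.card β ^ (l - g) := by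
  rw [levelWords, Fintype.card_piFinset, ← Finset.prod_ite_const_fin l g _ _ hg]
  refine Finset.prod_congr rfl fun k _ => ?_
  unfold levelLetters
  split_ifs <;> simp

/-- Before position `g` the first factor is the identity, from `g` on the second one is. -/
theorem sum_letterCoeff_mul (c : α → β → ℤ) {g h k : ℕ} (hgh : g ≤ h) {e : α ⊕ β}
    (he : e ∈ levelLetters α β h k) (z : β) :
    ∑ e' ∈ levelLetters α β g k, letterCoeff c e e' * letterCoeff c e' (Sum.inr z) =
      letterCoeff c e (Sum.inr z) := by
  unfold levelLetters at he ⊢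
  by_cases hk : k < g
  · rw [if_pos (hk.trans_le hgh)] at he
    obtain ⟨m, -, rfl⟩ := Finset.mem_map.1 he
    simp [hk, letterCoeff]
  · rw [if_neg hk]
    rcases e with m | Q <;> simp [letterCoeff]

/-- Only positions from `g` to `h - 1` change alphabet; elsewhere the coefficients form an identity
matrix. -/
theorem sum_abs_letterCoeff_le (c : α → β → ℤ) (hc : ∀ m Q, |c m Q| ≤ 1) {g h k : ℕ} (hgh : g ≤ h)
    {e : α ⊕ β} (he : e ∈ levelLetters α β h k) :
    ∑ e' ∈ levelLetters α β g k, |letterCoeff c e e'| ≤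
      if g ≤ k ∧ k < h then (Fintype.card β : ℤ) else 1 := by
  unfold levelLetters at he ⊢
  by_cases hk : k < g
  · rw [if_pos (hk.trans_le hgh)] at he
    obtain ⟨m, -, rfl⟩ := Finset.mem_map.1 he
    rw [if_pos hk, if_neg (by omega)]
    simp [letterCoeff, apply_ite abs]
  · rw [if_neg hk]
    by_cases hk' : k < h
    · rw [if_pos hk'] at he
      obtain ⟨m, -, rfl⟩ := Finset.mem_map.1 he
      rw [if_pos ⟨not_lt.1 hk, hk'⟩, Finset.sum_map]
      refine (Finset.sum_le_sum fun Q _ => hc m Q).trans ?_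
      simp
    · rw [if_neg hk'] at he
      obtain ⟨Q, -, rfl⟩ := Finset.mem_map.1 he
      rw [if_neg (by omega)]
      simp [letterCoeff, apply_ite abs]

/-- The one-letter identity `sum_letterCoeff_mul` multiplied over all positions; any number of
levels can be skipped at once. -/
theorem wordValue_eq_sum {l g h : ℕ} (c : α → β → ℤ) (A : (Fin l → β) → ℤ) (hgh : g ≤ h)
    {w : Fin l → α ⊕ β} (hw : w ∈ levelWords α β l h) :
    wordValue c A w =
      ∑ w' ∈ levelWords α β l g, (∏ k, letterCoeff c (w k) (w' k)) * wordValue c A w' := by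
  simp only [wordValue, Finset.mul_sum]
  rw [Finset.sum_comm]
  refine Finset.sum_congr rfl fun P _ => ?_
  simp only [← mul_assoc, ← Finset.sum_mul, ← Finset.prod_mul_distrib]
  congr 1
  refine Eq.trans ?_ (Finset.prod_univ_sum (fun k : Fin l => levelLetters α β g k)
    fun k e => letterCoeff c (w k) e * letterCoeff c e (Sum.inr (P k)))
  exact Finset.prod_congr rfl fun k _ =>
    (sum_letterCoeff_mul c hgh (Fintype.mem_piFinset.1 hw k) (P k)).symm

theorem sum_abs_prod_letterCoeff_le {l g h : ℕ} (c : α → β → ℤ) (hc : ∀ m Q, |c m Q| ≤ 1)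
    (hgh : g ≤ h) (hh : h ≤ l) {w : Fin l → α ⊕ β} (hw : w ∈ levelWords α β l h) :
    ∑ w' ∈ levelWords α β l g, |∏ k, letterCoeff c (w k) (w' k)| ≤
      (Fintype.card β ^ (h - g) : ℕ) := by
  simp only [Finset.abs_prod]
  refine (Finset.prod_univ_sum (fun k : Fin l => levelLetters α β g k)
    fun k e => |letterCoeff c (w k) e|).symm.le.trans ?_
  refine (Finset.prod_le_prod (fun k _ => Finset.sum_nonneg fun _ _ => abs_nonneg _) fun k _ =>
    sum_abs_letterCoeff_le c hc hgh (Fintype.mem_piFinset.1 hw k)).trans (le_of_eq ?_)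
  rw [Fin.prod_univ_eq_prod_range
    (fun k => if g ≤ k ∧ k < h then (Fintype.card β : ℤ) else 1) l, Finset.prod_ite,
    Finset.prod_const_one, mul_one, Finset.prod_const,
    show (Finset.range l).filter (fun k => g ≤ k ∧ k < h) = Finset.Ico g h by ext; simp; omega,
    Nat.card_Ico, Nat.cast_pow]

theorem exists_eq_inr_of_mem_levelWords_zero {l : ℕ} {w : Fin l → α ⊕ β}
    (hw : w ∈ levelWords α β l 0) : ∃ Q : Fin l → β, w = fun k => Sum.inr (Q k) := by
  have : ∀ k, ∃ Q, w k = Sum.inr Q := fun k => by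
    have h := Fintype.mem_piFinset.1 hw k
    rw [levelLetters, if_neg (Nat.not_lt_zero _)] at h
    obtain ⟨Q, -, hQ⟩ := Finset.mem_map.1 h
    exact ⟨Q, hQ.symm⟩
  choose Q hQ using this
  exact ⟨Q, funext hQ⟩

theorem inl_mem_levelWords {l : ℕ} (m : Fin l → α) :
    (fun k => Sum.inl (m k)) ∈ levelWords α β l l := by
  refine Fintype.mem_piFinset.2 fun k => ?_
  rw [levelLetters, if_pos k.2]
  exact Finset.mem_map_of_mem _ (Finset.mem_univ _)

end Words

namespace ThresholdCircuit.ComputesInt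

variable {ι α β τ : Type} [Fintype ι] [Fintype α] [Fintype β] [DecidableEq α] [DecidableEq β]
  [Fintype τ] {l d s B : ℕ} {c : τ → α → β → ℤ} {A : (Fin l → β) → (ι → Bool) → ℤ}

/-- Passing from the words of level `g` to those of level `h`. -/
theorem levelWords_step (hc : ∀ t m Q, |c t m Q| ≤ 1) {g h : ℕ} (hgh : g ≤ h) (hh : h ≤ l)
    (hv : ComputesInt d s B fun (p : τ × levelWords α β l g) x =>
      wordValue (c p.1) (fun P => A P x) p.2) :
    ComputesInt (d + 2)
      (s + Fintype.card τ * (Fintype.card α ^ h * Fintype.card β ^ (l - h)) * B *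
        (4 * Fintype.card β ^ (h - g) + 1)) B
      fun (p : τ × levelWords α β l h) x => wordValue (c p.1) (fun P => A P x) p.2 := by
  classical
  have hcard : Fintype.card (τ × levelWords α β l h) =
      Fintype.card τ * (Fintype.card α ^ h * Fintype.card β ^ (l - h)) := by
    rw [Fintype.card_prod, Fintype.card_coe, card_levelWords hh]
  rw [← hcard]
  refine hv.linear (fun p p' => if p'.1 = p.1 then
    ∏ k, letterCoeff (c p.1) (p.2.1 k) (p'.2.1 k) else 0) _ ?_ ?_
  · rintro ⟨t, w, hw⟩ x
    rw [Fintype.sum_prod_type, Finset.sum_eq_single t]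
    · rw [wordValue_eq_sum _ _ hgh hw, ← Finset.sum_coe_sort]
      simp
    · intro t' _ ht
      simp [ht]
    · simp
  · rintro ⟨t, w, hw⟩
    rw [Fintype.sum_prod_type, Finset.sum_eq_single t]
    · refine le_trans (le_of_eq ?_) (sum_abs_prod_letterCoeff_le (c t) (hc t) hgh hh hw)
      rw [← Finset.sum_coe_sort (levelWords α β l g)]
      simp
    · intro t' _ ht
      simp [ht]
    · simp

end ThresholdCircuit.ComputesInt

/-! ### The schedule of levels and its cost. -/

section Levels

/-- The number of letters that are still to be treated when `j` steps remain. -/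
def remaining (q : ℕ) : ℕ → ℕ
  | 0 => 0
  | j + 1 => remaining q j + remaining q j / q + 1

theorem remaining_mono (q : ℕ) : Monotone (remaining q) :=
  monotone_nat_of_le_succ fun j => by rw [remaining, add_assoc]; exact Nat.le_add_right _ _

/-- Each of the `q` steps adds at least `R / q + 1` for the initial value `R`, and `q * (R / q + 1)
≥ R + 1`. -/
theorem two_mul_remaining_le {q : ℕ} (hq : 0 < q) (j : ℕ) :
    2 * (remaining q j + 1) ≤ remaining q (j + q) + 1 := by
  have h : ∀ i ≤ q, remaining q j + i * (remaining q j / q + 1) ≤ remaining q (j + i) := by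
    intro i
    induction i with
    | zero => simp
    | succ i ih =>
      intro hi
      have h1 := ih (by omega)
      have h2 : remaining q j / q ≤ remaining q (j + i) / q :=
        Nat.div_le_div_right (remaining_mono q (Nat.le_add_right j i))
      rw [← add_assoc, remaining, Nat.add_mul, one_mul]
      omega
  have h1 := h q le_rfl
  have h2 := Nat.div_add_mod (remaining q j) q
  have h3 := Nat.mod_lt (remaining q j) hq
  rw [Nat.mul_add, mul_one] at h1
  omega

theorem two_pow_le_remaining {q : ℕ} (hq : 0 < q) (k : ℕ) : 2 ^ k ≤ remaining q (q * k) + 1 := by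
  induction k with
  | zero => simp
  | succ k ih =>
    rw [pow_succ', Nat.mul_succ]
    exact (Nat.mul_le_mul_left 2 ih).trans (two_mul_remaining_le hq _)

theorem le_remaining {q : ℕ} (hq : 0 < q) (l : ℕ) : l ≤ remaining q (q * (Nat.log 2 l + 1)) := by
  have h1 := two_pow_le_remaining hq (Nat.log 2 l + 1)
  have h2 := Nat.lt_pow_succ_log_self one_lt_two l
  omega

/-- The powers of `r / a > 1` eventually exceed `a`. This is where the strict inequality `T ^ 2 < r`
enters. -/
theorem exists_pow_succ_le_pow {a r : ℕ} (ha : 0 < a) (har : a < r) :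
    ∃ q, 0 < q ∧ a ^ (q + 1) ≤ r ^ q := by
  have h1 : (1 : ℝ) < r / a := by
    rw [one_lt_div (by exact_mod_cast ha)]
    exact_mod_cast har
  obtain ⟨q, hq⟩ := pow_unbounded_of_one_lt (a : ℝ) h1
  refine ⟨q + 1, Nat.succ_pos q, ?_⟩
  have h2 : (a : ℝ) * a ^ q < r ^ q := by
    rwa [div_pow, lt_div_iff₀ (by positivity)] at hq
  have h3 : a * a ^ q < r ^ q := by exact_mod_cast h2
  calc a ^ (q + 1 + 1) = a * (a * a ^ q) := by ring
    _ ≤ r * r ^ q := Nat.mul_le_mul har.le h3.le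
    _ = r ^ (q + 1) := by ring

theorem pow_add_div_le {a r q : ℕ} (har : a ≤ r) (hq : a ^ (q + 1) ≤ r ^ q) (R : ℕ) :
    a ^ (R + R / q) ≤ r ^ R := by
  have h := Nat.div_add_mod R q
  calc a ^ (R + R / q) = (a ^ (q + 1)) ^ (R / q) * a ^ (R % q) := by
        rw [← pow_mul, ← pow_add]
        congr 1
        rw [add_mul, one_mul]
        omega
    _ ≤ (r ^ q) ^ (R / q) * r ^ (R % q) :=
        Nat.mul_le_mul (Nat.pow_le_pow_left hq _) (Nat.pow_le_pow_left har _)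
    _ = r ^ R := by rw [← pow_mul, ← pow_add, h]

/-- The product of node count and combination length is about `r ^ (l - R) * a ^ (R + R / q)`, and
`pow_add_div_le` trades the second factor for `r ^ R`. -/
theorem level_cost_le {a r q : ℕ} (ha : 0 < a) (har : a ≤ r) (hq : a ^ (q + 1) ≤ r ^ q) (l j : ℕ) :
    r ^ (l - remaining q j) * a ^ (l - (l - remaining q j)) *
      (4 * a ^ ((l - remaining q j) - (l - remaining q (j + 1))) + 1) ≤ 5 * a * r ^ l := by
  -- Here truncated subtraction makes both levels `0`: an idle step at the start of the schedule.
  rcases le_total l (remaining q j) with h | h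
  · have h' := h.trans (remaining_mono q (Nat.le_succ j))
    rw [Nat.sub_eq_zero_of_le h, Nat.sub_eq_zero_of_le h', Nat.sub_zero, Nat.sub_zero, pow_zero,
      pow_zero, one_mul, mul_one, mul_comm]
    calc (4 + 1) * a ^ l ≤ 5 * r ^ l := Nat.mul_le_mul_left _ (Nat.pow_le_pow_left har l)
      _ ≤ 5 * a * r ^ l := Nat.mul_le_mul_right _ (by omega)
  · have hδ : (l - remaining q j) - (l - remaining q (j + 1)) ≤ remaining q j / q + 1 := by
      rw [remaining]
      generalize remaining q j / q = u
      omega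
    set R := remaining q j
    rw [Nat.sub_sub_self h]
    calc r ^ (l - R) * a ^ R * (4 * a ^ ((l - R) - (l - remaining q (j + 1))) + 1)
        ≤ r ^ (l - R) * a ^ R * (4 * a ^ (R / q + 1) + a ^ (R / q + 1)) := by
          refine Nat.mul_le_mul_left _ (Nat.add_le_add (Nat.mul_le_mul_left _
            (Nat.pow_le_pow_right ha hδ)) (Nat.one_le_pow _ _ ha))
      _ = 5 * a * (r ^ (l - R) * a ^ (R + R / q)) := by ring
      _ ≤ 5 * a * (r ^ (l - R) * r ^ R) :=
          Nat.mul_le_mul_left _ (Nat.mul_le_mul_left _ (pow_add_div_le har hq R))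
      _ = 5 * a * r ^ l := by rw [← pow_add, Nat.sub_add_cancel h]

end Levels

/-! ### Computing all leaves. -/

namespace ThresholdCircuit.ComputesInt

variable {ι α β τ : Type} [Fintype ι] [Fintype α] [Fintype β] [DecidableEq α] [DecidableEq β]
  [Fintype τ] {l d s B : ℕ} {c : τ → α → β → ℤ} {A : (Fin l → β) → (ι → Bool) → ℤ}

theorem leaves_of_levelWords (hc : ∀ t m Q, |c t m Q| ≤ 1) {q : ℕ} (hβ : 0 < Fintype.card β)
    (hαβ : Fintype.card β ≤ Fintype.card α)
    (hq : Fintype.card β ^ (q + 1) ≤ Fintype.card α ^ q) (j : ℕ)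
    (hv : ComputesInt d s B fun (p : τ × levelWords α β l (l - remaining q j)) x =>
      wordValue (c p.1) (fun P => A P x) p.2) :
    ComputesInt (d + 2 * j)
      (s + j * (Fintype.card τ * B * (5 * Fintype.card β * Fintype.card α ^ l))) B
      fun (p : τ × levelWords α β l l) x => wordValue (c p.1) (fun P => A P x) p.2 := by
  induction j generalizing d s with
  | zero =>
    rw [remaining, Nat.sub_zero] at hv
    simpa using hv
  | succ j ih =>
    have h1 := hv.levelWords_step (A := A) hc (h := l - remaining q j)
      (Nat.sub_le_sub_left (remaining_mono q (Nat.le_succ j)) l) (Nat.sub_le _ _)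
    refine (ih h1).mono (by omega) ?_
    rw [Nat.add_mul j 1, one_mul, add_assoc, add_comm (j * _)]
    refine Nat.add_le_add_left (Nat.add_le_add_right ?_ _) s
    calc _ = Fintype.card τ * B * (Fintype.card α ^ (l - remaining q j) *
          Fintype.card β ^ (l - (l - remaining q j)) *
          (4 * Fintype.card β ^ ((l - remaining q j) - (l - remaining q (j + 1))) + 1)) := by ring
      _ ≤ _ := Nat.mul_le_mul_left _ (level_cost_le hβ hαβ hq l j)

/-- The values of all leaves, from the entries of the given matrix. -/
theorem leaves (hc : ∀ t m Q, |c t m Q| ≤ 1) {q : ℕ} (hq0 : 0 < q) (hβ : 0 < Fintype.card β)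
    (hαβ : Fintype.card β ≤ Fintype.card α)
    (hq : Fintype.card β ^ (q + 1) ≤ Fintype.card α ^ q) (hA : ComputesInt d s B A) :
    ComputesInt (d + 2 * (q * (Nat.log 2 l + 1)))
      (s + q * (Nat.log 2 l + 1) *
        (Fintype.card τ * B * (5 * Fintype.card β * Fintype.card α ^ l))) B
      fun (p : τ × (Fin l → α)) x =>
        wordValue (c p.1) (fun P => A P x) fun k => Sum.inl (p.2 k) := by
  have h0 : ComputesInt d s B fun (p : τ × levelWords α β l 0) x =>
      wordValue (c p.1) (fun P => A P x) p.2 := by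
    choose Q hQ using fun w : levelWords α β l 0 => exists_eq_inr_of_mem_levelWords_zero w.2
    have h := hA.comp fun p : τ × levelWords α β l 0 => Q p.2
    refine Eq.mp (congrArg _ (funext fun p => funext fun x => ?_)) h
    rw [hQ p.2, wordValue_inr]
  -- By truncation, the schedule with this many steps left starts at level `0`.
  rw [← Nat.sub_eq_zero_of_le (le_remaining hq0 l)] at h0
  exact (leaves_of_levelWords hc hβ hαβ hq _ h0).comp
    fun p : τ × (Fin l → α) => (p.1, ⟨fun k => Sum.inl (p.2 k), inl_mem_levelWords p.2⟩)

end ThresholdCircuit.ComputesInt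

/-! ### The trace of a cube as a sum of triple products. -/

namespace FastMatMul

variable {T r : ℕ}

/-- The coefficients of the three linear forms whose products sum to the trace of a product of
three matrices. -/
def traceCoeff (alg : FastMatMul T r) : Fin 3 → Fin r → Fin T × Fin T → ℤ :=
  ![fun m P => alg.coeffA m P.1 P.2, fun m P => alg.coeffB m P.1 P.2,
    -- Transposed, because the trace of `X * Y * Z` pairs entry `(i, j)` of `X * Y` with entry `(j,
    -- i)` of `Z`.
    fun m P => alg.coeffC m P.2 P.1]

theorem abs_traceCoeff_le (alg : FastMatMul T r) (t : Fin 3) (m : Fin r) (P : Fin T × Fin T) :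
    |alg.traceCoeff t m P| ≤ 1 := by
  have h : ∀ σ : SignType, |(σ : ℤ)| ≤ 1 := by decide
  fin_cases t
  · exact h _
  · exact h _
  · exact h _

/-- The identity `correct`, evaluated at matrix units, gives the coefficients of the matrix
multiplication tensor. -/
theorem sum_traceCoeff (alg : FastMatMul T r) (P Q S : Fin T × Fin T) :
    ∑ m, alg.traceCoeff 0 m P * alg.traceCoeff 1 m Q * alg.traceCoeff 2 m S =
      if P.2 = Q.1 ∧ Q.2 = S.1 ∧ S.2 = P.1 then 1 else 0 := by
  have hsum : ∀ (f : Fin T → Fin T → ℤ) (P : Fin T × Fin T),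
      ∑ p, ∑ q, f p q * Matrix.single P.1 P.2 (1 : ℤ) p q = f P.1 P.2 := by
    intro f P
    rw [Finset.sum_eq_single P.1, Finset.sum_eq_single P.2]
    · simp
    · intro q _ hq
      simp [hq.symm]
    · simp
    · intro p _ hp
      simp [hp.symm]
    · simp
  have h := alg.correct (Matrix.single P.1 P.2 1) (Matrix.single Q.1 Q.2 1) S.2 S.1
  simp only [hsum fun p q => (alg.coeffA _ p q : ℤ), hsum fun p q => (alg.coeffB _ p q : ℤ)] at h
  calc _ = ∑ m, (alg.coeffC m S.2 S.1 : ℤ) *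
        ((alg.coeffA m P.1 P.2 : ℤ) * (alg.coeffB m Q.1 Q.2 : ℤ)) :=
        Finset.sum_congr rfl fun m _ => by simp [traceCoeff]; ring
    _ = _ := h.symm
    _ = _ := by
      by_cases hPQ : P.2 = Q.1
      · rw [hPQ, Matrix.single_mul_single_same, Matrix.single_apply]
        simp only [mul_one, true_and]
        exact if_congr ⟨fun h => ⟨h.2, h.1.symm⟩, fun h => ⟨h.2.symm, h.1⟩⟩ rfl rfl
      · rw [Matrix.single_mul_single_of_ne _ _ _ _ hPQ]
        simp [hPQ]

/-- The trace of the cube of a matrix, from the recursive use of the algorithm. -/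
theorem sum_wordValue (alg : FastMatMul T r) {l : ℕ}
    (A : (Fin l → Fin T) → (Fin l → Fin T) → ℤ) :
    ∑ m : Fin l → Fin r, ∏ t, wordValue (alg.traceCoeff t)
      (fun P => A (fun k => (P k).1) fun k => (P k).2) (fun k => Sum.inl (m k)) =
      ∑ i, ∑ j, ∑ k, A i j * A j k * A k i := by
  set A' : (Fin l → Fin T × Fin T) → ℤ := fun P => A (fun k => (P k).1) fun k => (P k).2
  have h1 : ∀ m : Fin l → Fin r, ∏ t, wordValue (alg.traceCoeff t) A' (fun k => Sum.inl (m k)) =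
      ∑ P, ∑ Q, ∑ S, A' P * A' Q * A' S * ∏ k, (alg.traceCoeff 0 (m k) (P k) *
        alg.traceCoeff 1 (m k) (Q k) * alg.traceCoeff 2 (m k) (S k)) := by
    intro m
    simp only [Fin.prod_univ_three, wordValue, letterCoeff, Finset.prod_mul_distrib]
    rw [Finset.sum_mul_sum, Finset.sum_mul]
    refine Finset.sum_congr rfl fun P _ => ?_
    rw [Finset.sum_mul]
    refine Finset.sum_congr rfl fun Q _ => ?_
    rw [Finset.mul_sum]
    exact Finset.sum_congr rfl fun S _ => by ring
  -- The sum over words `m` of a product over positions is the product over positions of one-letter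
  -- sums.
  have h2 : ∀ P Q S : Fin l → Fin T × Fin T, ∑ m : Fin l → Fin r,
      ∏ k, (alg.traceCoeff 0 (m k) (P k) * alg.traceCoeff 1 (m k) (Q k) *
        alg.traceCoeff 2 (m k) (S k)) =
      if (fun k => (P k).2) = (fun k => (Q k).1) ∧ (fun k => (Q k).2) = (fun k => (S k).1) ∧
        (fun k => (S k).2) = (fun k => (P k).1) then 1 else 0 := by
    intro P Q S
    have h := Finset.prod_univ_sum (fun _ : Fin l => (Finset.univ : Finset (Fin r)))
      fun k m => alg.traceCoeff 0 m (P k) * alg.traceCoeff 1 m (Q k) * alg.traceCoeff 2 m (S k)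
    rw [Fintype.piFinset_univ] at h
    rw [← h]
    simp only [sum_traceCoeff]
    rw [Finset.prod_ite_zero]
    simp only [Finset.prod_const_one, Finset.mem_univ, forall_true_left, forall_and, funext_iff]
  simp only [h1]
  rw [Finset.sum_comm]
  simp only [Finset.sum_comm (s := (Finset.univ : Finset (Fin l → Fin r))), ← Finset.mul_sum, h2]
  let E := Equiv.arrowProdEquivProdArrow (Fin l) (fun _ => Fin T) (fun _ => Fin T)
  have hE : ∀ f : (Fin l → Fin T × Fin T) → ℤ, ∑ P, f P =
      ∑ i : Fin l → Fin T, ∑ j : Fin l → Fin T, f fun k => (i k, j k) := by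
    intro f
    exact (E.symm.sum_comp f).symm.trans (Fintype.sum_prod_type _)
  simp only [hE, A']
  refine Finset.sum_congr rfl fun i _ => Finset.sum_congr rfl fun j _ => ?_
  rw [Finset.sum_eq_single j]
  · refine Finset.sum_congr rfl fun k _ => ?_
    rw [Finset.sum_eq_single k, Finset.sum_eq_single i]
    · simp
    · intro i' _ hi
      simp [hi]
    · simp
    · intro k' _ hk
      simp [hk.symm]
    · simp
  · intro j' _ hj
    simp [hj.symm]
  · simp

end FastMatMul

/-! ### The circuit for fixed `l` and its explicit size. -/

theorem Matrix.trace_pow_three {n m : Type*} [Fintype n] [DecidableEq n] [Fintype m] (e : m ≃ n)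
    (M : Matrix n n ℤ) :
    (M ^ 3).trace = ∑ i, ∑ j, ∑ k, M (e i) (e j) * M (e j) (e k) * M (e k) (e i) := by
  rw [pow_three, ← mul_assoc, Matrix.trace, ← e.sum_comp]
  refine Finset.sum_congr rfl fun i _ => ?_
  simp only [Matrix.diag_apply, Matrix.mul_apply, Finset.sum_mul]
  rw [Finset.sum_comm, ← e.sum_comp]
  refine Finset.sum_congr rfl fun j _ => ?_
  rw [← e.sum_comp]

theorem abs_matrixOfBits_le {N b : ℕ} (x : MatrixBit N b → Bool) (i j : Fin N) :
    |matrixOfBits x i j| ≤ 2 ^ b := by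
  have h : ∀ f : Fin b → Bool, 0 ≤ (∑ k, if f k then (2 : ℤ) ^ (k : ℕ) else 0) ∧
      (∑ k, if f k then (2 : ℤ) ^ (k : ℕ) else 0) ≤ 2 ^ b := by
    refine fun f => ⟨Finset.sum_nonneg fun k _ => by split_ifs <;> positivity, ?_⟩
    refine (Finset.sum_le_sum (g := fun k : Fin b => (2 : ℤ) ^ (k : ℕ)) fun k _ => ?_).trans ?_
    · split_ifs
      · exact le_rfl
      · positivity
    · rw [Fin.sum_univ_eq_sum_range (fun k => (2 : ℤ) ^ k) b]
      have := mul_geom_sum (2 : ℤ) b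
      linarith
  have h1 := h fun k => x (i, j, true, k)
  have h2 := h fun k => x (i, j, false, k)
  rw [matrixOfBits, Matrix.of_apply, abs_le]
  constructor <;> linarith [h1.1, h1.2, h2.1, h2.2]

/-- The number of bits of the intermediate results, when matrix entries have `b` bits. -/
def workingBits (T b l : ℕ) : ℕ := b + 2 * T * l + 2

theorem FastMatMul.exists_circuit {T r : ℕ} (hT : 0 < T) (hr : T * T < r) (alg : FastMatMul T r)
    {q : ℕ} (hq0 : 0 < q) (hq : (T * T) ^ (q + 1) ≤ r ^ q) (b l : ℕ) (τ : ℤ) :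
    ∃ C : ThresholdCircuit (MatrixBit (T ^ l) b),
      C.depth ≤ 4 + 2 * (q * (Nat.log 2 l + 1)) + 2 ∧
      C.size ≤ (14 + 15 * q * (T * T)) * (r ^ l * workingBits T b l ^ 4) ∧
      ∀ x, C.eval x = true ↔ τ ≤ (matrixOfBits x ^ 3).trace := by
  set B := workingBits T b l with hB
  let e : (Fin l → Fin T) ≃ Fin (T ^ l) := finFunctionFinEquiv
  have hA := ThresholdCircuit.ComputesInt.ofInput B
    fun (P : Fin l → Fin T × Fin T) (σ : Bool) (k : Fin b) =>
      ((e fun k => (P k).1, e fun k => (P k).2, σ, k) : MatrixBit (T ^ l) b)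
  have hv := hA.leaves (c := alg.traceCoeff) alg.abs_traceCoeff_le hq0
    (by simpa using Nat.mul_pos hT hT) (by simpa using hr.le) (by simpa using hq)
  -- A leaf combines `(T * T) ^ l` entries of size at most `2 ^ b`, and `T ≤ 2 ^ T`. The last bit of
  -- `workingBits` is for the sign.
  have hbound : ∀ (t : Fin 3) (m : Fin l → Fin r) (x : MatrixBit (T ^ l) b → Bool),
      |wordValue (alg.traceCoeff t) (fun P => matrixOfBits x (e fun k => (P k).1)
        (e fun k => (P k).2)) fun k => Sum.inl (m k)| < 2 ^ (b + 2 * T * l + 1) := by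
    intro t m x
    refine (abs_wordValue_le _ (alg.abs_traceCoeff_le t)
      (fun P => abs_matrixOfBits_le x _ _) _).trans_lt ?_
    have h1 : (T * T) ^ l ≤ 2 ^ (2 * T * l) := by
      rw [pow_mul]
      refine Nat.pow_le_pow_left ?_ l
      rw [two_mul, pow_add]
      exact Nat.mul_le_mul Nat.lt_two_pow_self.le Nat.lt_two_pow_self.le
    have h2 : (T * T) ^ l * 2 ^ b < 2 ^ (b + 2 * T * l + 1) := by
      calc _ ≤ 2 ^ (2 * T * l) * 2 ^ b := Nat.mul_le_mul_right _ h1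
        _ = 2 ^ (b + 2 * T * l) := by rw [← pow_add, add_comm]
        _ < _ := Nat.pow_lt_pow_right one_lt_two (Nat.lt_succ_self _)
    have h3 : (Fintype.card (Fin T × Fin T) : ℤ) ^ l * 2 ^ b = ((T * T) ^ l * 2 ^ b : ℕ) := by
      simp
    rw [h3]
    exact_mod_cast h2
  obtain ⟨C, hd, hs, hC⟩ := ThresholdCircuit.ComputesInt.exists_le_sum_mul (B := b + 2 * T * l + 1) hv
    (fun p x => (abs_lt.1 (hbound p.1 p.2 x)).1.le) (fun p x => (abs_lt.1 (hbound p.1 p.2 x)).2) τ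
  refine ⟨C, hd, hs.trans ?_, fun x => ?_⟩
  · simp only [Fintype.card_pi, Fintype.card_prod, Fintype.card_fin, Finset.prod_const,
      Finset.card_univ]
    change _ + r ^ l * B ^ 3 + 1 ≤ _
    have hB1 : 1 ≤ B := by rw [hB, workingBits]; omega
    have hr1 : 1 ≤ r ^ l := Nat.one_le_pow _ _ (by omega)
    have ha : (T * T) ^ l ≤ r ^ l := Nat.pow_le_pow_left hr.le l
    have hlog : Nat.log 2 l + 1 ≤ B := by
      have h1 := Nat.log_le_self 2 l
      have h2 : l ≤ 2 * T * l := Nat.le_mul_of_pos_left l (by omega)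
      rw [hB, workingBits]
      omega
    have p1 : 1 ≤ r ^ l * B ^ 4 := Nat.mul_pos hr1 (Nat.one_le_pow _ _ hB1)
    have p2 : (T * T) ^ l * B ≤ r ^ l * B ^ 4 :=
      Nat.mul_le_mul ha (Nat.le_self_pow (by norm_num) B)
    have p3 : r ^ l * B ^ 3 ≤ r ^ l * B ^ 4 :=
      Nat.mul_le_mul_left _ (Nat.pow_le_pow_right hB1 (by norm_num))
    have p4 : q * (Nat.log 2 l + 1) * (3 * B * (5 * (T * T) * r ^ l)) ≤
        15 * q * (T * T) * (r ^ l * B ^ 4) := by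
      calc _ = 15 * q * (T * T) * (r ^ l * ((Nat.log 2 l + 1) * B)) := by ring
        _ ≤ 15 * q * (T * T) * (r ^ l * (B * B)) :=
          Nat.mul_le_mul_left _ (Nat.mul_le_mul_left _ (Nat.mul_le_mul_right _ hlog))
        _ ≤ _ := Nat.mul_le_mul_left _ (Nat.mul_le_mul_left _ (by
          rw [← sq]
          exact Nat.pow_le_pow_right hB1 (by norm_num)))
    -- The constant 14 is `1 + 2 + 9` from the input stage, `1` from the digit products and `1` for
    -- the output gate.
    rw [Nat.add_mul 14]
    have e1 : (T * T) ^ l * (2 * B) = 2 * ((T * T) ^ l * B) := by ring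
    rw [e1]
    omega
  · rw [hC, Matrix.trace_pow_three e, ← alg.sum_wordValue fun i j => matrixOfBits x (e i) (e j)]
    simp only [Fin.prod_univ_three]
    rfl

/-! ### Growth of the depth and size bounds. -/

section Asymptotics

variable {T : ℕ}

theorem natLog_mul_log_le (T : ℕ) {N : ℕ} (hN : N ≠ 0) :
    (Nat.log T N : ℝ) * Real.log T ≤ Real.log N := by
  rcases Nat.eq_zero_or_pos T with rfl | hT
  · simpa using Real.log_natCast_nonneg N
  · rw [← Real.log_pow]
    refine Real.log_le_log (by positivity) ?_
    exact_mod_cast Nat.pow_log_le_self T hN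

theorem natLog_le_two_mul_log (hT : 2 ≤ T) {N : ℕ} (hN : N ≠ 0) :
    (Nat.log T N : ℝ) ≤ 2 * Real.log N := by
  have h1 : Real.log 2 ≤ Real.log T := Real.log_le_log two_pos (by exact_mod_cast hT)
  have h2 := natLog_mul_log_le T hN
  have h3 : (Nat.log T N : ℝ) * (1 / 2) ≤ Nat.log T N * Real.log T :=
    mul_le_mul_of_nonneg_left (by linarith [Real.log_two_gt_d9]) (Nat.cast_nonneg _)
  linarith

theorem tendsto_log_natCast : Tendsto (fun N : ℕ => Real.log N) atTop atTop :=
  Real.tendsto_log_atTop.comp tendsto_natCast_atTop_atTop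

theorem isBigO_natLog_natLog (hT : 2 ≤ T) :
    (fun N : ℕ => (Nat.log 2 (Nat.log T N) : ℝ)) =O[atTop] fun N : ℕ => Real.log (Real.log N) := by
  -- One factor 2 comes from `log 2 > 1 / 2`, the other from absorbing the `log 2` in `log (2 * log
  -- N)`.
  refine IsBigO.of_bound 4 ?_
  filter_upwards [(Real.tendsto_log_atTop.comp tendsto_log_natCast).eventually_ge_atTop 1,
    tendsto_log_natCast.eventually_ge_atTop 1, eventually_ne_atTop 0] with N h1 h2 h3
  simp only [Function.comp_apply] at h1
  rw [Real.norm_of_nonneg (Nat.cast_nonneg _), Real.norm_of_nonneg (by linarith)]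
  rcases Nat.eq_zero_or_pos (Nat.log T N) with h | h
  · rw [h, Nat.log_zero_right, Nat.cast_zero]
    linarith
  · have h4 := natLog_mul_log_le 2 h.ne'
    have h5 : Real.log (Nat.log T N) ≤ Real.log (2 * Real.log N) :=
      Real.log_le_log (by exact_mod_cast h) (natLog_le_two_mul_log hT h3)
    rw [Real.log_mul two_ne_zero (by linarith)] at h5
    have h6 := Real.log_two_gt_d9
    have h7 := Real.log_two_lt_d9
    have h8 : (Nat.log 2 (Nat.log T N) : ℝ) * (1 / 2) ≤
        Nat.log 2 (Nat.log T N) * Real.log (2 : ℕ) :=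
      mul_le_mul_of_nonneg_left (by push_cast; linarith) (Nat.cast_nonneg _)
    have h9 := h8.trans (h4.trans h5)
    linarith

theorem pow_natLog_le_rpow (hT : 2 ≤ T) {r N : ℕ} (hr : 1 ≤ r) (hN : N ≠ 0) :
    ((r : ℝ) ^ Nat.log T N) ≤ (N : ℝ) ^ Real.logb T r := by
  have hT1 : (1 : ℝ) < T := by exact_mod_cast hT
  have hr0 : (0 : ℝ) < r := by exact_mod_cast hr
  calc (r : ℝ) ^ Nat.log T N = ((T : ℝ) ^ Real.logb T r) ^ Nat.log T N := by
        rw [Real.rpow_logb (by linarith) hT1.ne' hr0]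
    _ = ((T : ℝ) ^ Nat.log T N) ^ Real.logb T r := by
        rw [← Real.rpow_natCast, ← Real.rpow_natCast, ← Real.rpow_mul (by linarith),
          ← Real.rpow_mul (by linarith), mul_comm]
    _ ≤ _ := by
        refine Real.rpow_le_rpow (by positivity) ?_ (Real.logb_nonneg hT1 (by exact_mod_cast hr))
        exact_mod_cast Nat.pow_log_le_self T hN

theorem isBigO_workingBits (hT : 2 ≤ T) {b : ℕ → ℕ}
    (hb : (fun N : ℕ => (b N : ℝ)) =O[atTop] fun N : ℕ => Real.log N) :
    (fun N : ℕ => (workingBits T (b N) (Nat.log T N) : ℝ)) =O[atTop] fun N : ℕ => Real.log N := by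
  have h1 : (fun N : ℕ => (Nat.log T N : ℝ)) =O[atTop] fun N : ℕ => Real.log N := by
    refine IsBigO.of_bound 2 ?_
    filter_upwards [eventually_ne_atTop 0] with N hN
    rw [Real.norm_of_nonneg (Nat.cast_nonneg _), Real.norm_of_nonneg (Real.log_natCast_nonneg N)]
    exact natLog_le_two_mul_log hT hN
  have h2 : (fun _ : ℕ => (2 : ℝ)) =O[atTop] fun N : ℕ => Real.log N :=
    (isLittleO_const_left_of_ne two_ne_zero).2
      (tendsto_norm_atTop_atTop.comp tendsto_log_natCast) |>.isBigO
  refine ((hb.add (h1.const_mul_left (2 * T))).add h2).congr_left fun N => ?_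
  simp [workingBits]

end Asymptotics

theorem mainTheorem4 (T r : ℕ) (hT : 2 ≤ T) (hr : T ^ 2 < r) (alg : FastMatMul T r)
    (b : ℕ → ℕ) (hb : (fun N : ℕ => (b N : ℝ)) =O[atTop] fun N : ℕ => Real.log N) :
    ∃ (depthBound sizeBound : ℕ → ℕ) (c : ℕ),
      ((fun N : ℕ => (depthBound N : ℝ)) =O[atTop] fun N : ℕ => Real.log (Real.log N)) ∧
      ((fun N : ℕ => (sizeBound N : ℝ)) =O[atTop]
        fun N : ℕ => (N : ℝ) ^ Real.logb T r * Real.log N ^ c) ∧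
      ∀ N l : ℕ, 0 < l → N = T ^ l → ∀ τ : ℤ,
        ∃ C : ThresholdCircuit (MatrixBit N (b N)),
          C.depth ≤ depthBound N ∧ C.size ≤ sizeBound N ∧
          ∀ x : MatrixBit N (b N) → Bool,
            C.eval x = true ↔ τ ≤ (matrixOfBits x ^ 3).trace := by
  have hr' : T * T < r := by rwa [← sq]
  obtain ⟨q, hq0, hq⟩ := exists_pow_succ_le_pow (Nat.mul_pos (by omega) (by omega)) hr'
  -- The bounds may depend on `N` only, so `l` is recovered as `Nat.log T N`.
  refine ⟨fun N => 4 + 2 * (q * (Nat.log 2 (Nat.log T N) + 1)) + 2,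
    fun N => (14 + 15 * q * (T * T)) *
      (r ^ Nat.log T N * workingBits T (b N) (Nat.log T N) ^ 4), 4, ?_, ?_, ?_⟩
  · have h1 : (fun _ : ℕ => (6 + 2 * q : ℝ)) =O[atTop] fun N : ℕ => Real.log (Real.log N) :=
      ((isLittleO_const_left_of_ne (by positivity)).2 (tendsto_norm_atTop_atTop.comp
        (Real.tendsto_log_atTop.comp tendsto_log_natCast))).isBigO
    refine (((isBigO_natLog_natLog hT).const_mul_left (2 * q)).add h1).congr_left fun N => ?_
    push_cast
    ring
  · have h1 : (fun N : ℕ => (r : ℝ) ^ Nat.log T N) =O[atTop]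
        fun N : ℕ => (N : ℝ) ^ Real.logb T r := by
      refine IsBigO.of_bound 1 ?_
      filter_upwards [eventually_ne_atTop 0] with N hN
      rw [one_mul, Real.norm_of_nonneg (by positivity), Real.norm_of_nonneg (by positivity)]
      exact pow_natLog_le_rpow hT (by omega) hN
    refine ((h1.mul ((isBigO_workingBits hT hb).pow 4)).const_mul_left
      (14 + 15 * q * (T * T))).congr_left fun N => ?_
    push_cast
    ring
  · rintro N l - rfl τ
    have h := alg.exists_circuit (by omega) hr' hq0 hq (b (T ^ l)) l τ
    simpa only [Nat.log_pow hT] using h
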